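/- Let $\mathcal{LC}$ be the space of linear chirp functions, that is, of all functions $f:\mathbb{R}\to\mathbb{C}$ such that for every $\varepsilon>0$ there are finitely many real numbers $\omega_j,c_j,\alpha_j$ and complex numbers $B_j$ ($1\le j\le k$) with $$\sup_{x\in\mathbb{R}}\Big|f(x)-\sum_{j=1}^{k}B_j\,e^{i\{\omega_j+c_j(x-\alpha_j)\}x}\Big|\le\varepsilon .$$ Let $\lambda>0$, let $(X_n)_{n\in\mathbb{Z}}$ be independent random variables, each uniformly distributed on $[0,\lambda]$, and put $x_n=n\lambda+X_n$. Then almost every configuration $(x_n)_{n\in\mathbb{Z}}$ has the following property: every $f\in\mathcal{LC}$ with $f(x_n)=0$ for all $n\in\mathbb{Z}$ is identically zero. (The exceptional null set does not depend on $f$.) Moreover, $\mathcal{LC}$ strictly contains the space of almost periodic functions, i.e. of the functions $f:\mathbb{R}\to\mathbb{C}$ that can be approximated uniformly on $\mathbb{R}$, to within any $\varepsilon>0$, by trigonometric polynomials $\sum_{k=1}^{a}B_k e^{2\pi i\omega_k x}$ with $\omega_k\in\mathbb{R}$ and $B_k\in\mathbb{C}$. -/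

import Mathlib

/-- The linear chirp polynomial `∑ j, B j * exp (i (ω j + c j (x - α j)) x)`. -/
noncomputable def chirpPolynomial {k : ℕ} (ω c α : Fin k → ℝ) (B : Fin k → ℂ) (x : ℝ) : ℂ :=
  ∑ j, B j * Complex.exp (Complex.I * (((ω j + c j * (x - α j)) * x : ℝ) : ℂ))

/-- The trigonometric polynomial `∑ j, B j * exp (i (2π ω j) x)`. -/
noncomputable def trigPolynomial {k : ℕ} (ω : Fin k → ℝ) (B : Fin k → ℂ) (x : ℝ) : ℂ :=
  ∑ j, B j * Complex.exp (Complex.I * ((2 * Real.pi * ω j * x : ℝ) : ℂ))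

/-- The space of linear chirp functions: all functions on the real line that are
approximated uniformly, to within any `ε > 0`, by linear chirp polynomials. -/
def linearChirpSpace : Set (ℝ → ℂ) :=
  {f | ∀ ε : ℝ, 0 < ε → ∃ (k : ℕ) (ω c α : Fin k → ℝ) (B : Fin k → ℂ),
    ∀ x : ℝ, ‖f x - chirpPolynomial ω c α B x‖ ≤ ε}

/-- The (uniformly) almost periodic functions: all functions on the real line that are
approximated uniformly, to within any `ε > 0`, by trigonometric polynomials. -/
def almostPeriodicSpace : Set (ℝ → ℂ) :=
  {f | ∀ ε : ℝ, 0 < ε → ∃ (k : ℕ) (ω : Fin k → ℝ) (B : Fin k → ℂ),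
    ∀ x : ℝ, ‖f x - trigPolynomial ω B x‖ ≤ ε}

/-!
Expanding the exponents, a linear chirp polynomial is a finite combination of quadratic phases
`chirp (β, γ) x = exp (i (β x + γ x²))`. These phases form a group isomorphic to `ℝ × ℝ`, and the
whole argument rests on one property of the random points `x n`: almost surely, *every* non-constant
phase has mean zero along them (`ChirpEquidistributed`).

**Equidistribution gives uniqueness.** Orthogonality of the phases yields Parseval's identity for
the mean along `x n`. Hence a combination of `K` phases with modulus at most `M` at all points `x n`
has modulus at most `√K * M` everywhere, by Cauchy–Schwarz. Applying this to the `m`-th power of a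
combination `Q` of `k` phases, which involves at most `(m + 1) ^ k` phases, and taking `m`-th roots
as `m → ∞` removes the constant: `sup |Q| = sup |Q (x n)|` (`ChirpEquidistributed.norm_sum_le`).
If a linear chirp function `f` vanishes at all `x n` and `Q` approximates `f` to within `ε`, then
`|Q| ≤ ε` at the points `x n`, hence everywhere, so `|f| ≤ 2 ε` for every `ε`.

**The random points are equidistributed.** The expectation of a phase at `x n` is its average over
the cell `[n λ, (n + 1) λ]`. These expectations have mean zero: by the Riemann–Lebesgue lemma if
`γ ≠ 0`, and by telescoping if `γ = 0` (`tendsto_mean_cellMean`). The deviation from the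
expectation is controlled by Hoeffding's inequality, with an exponentially small failure
probability. A net of polynomially many phases suffices to control all phases with `|β|, |γ| ≤ N`
for the first `N` points, so Borel–Cantelli gives a null set independent of the phase
(`ae_forall_tendsto_chirpDeviation`).

**Strictness.** A phase with `γ ≠ 0` is orthogonal to all trigonometric polynomials, so it is at
uniform distance at least `1` from them (`chirp_notMem_almostPeriodicSpace`).
-/

section

open Filter Topology Finset ComplexConjugate

/-! ### Quadratic phases -/

/-- The quadratic phase `x ↦ exp (i (β x + γ x²))`, indexed by the pair `s = (β, γ)`. Indexing by a
pair makes multiplication of phases correspond to addition of indices in `ℝ × ℝ`. -/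
noncomputable def chirp (s : ℝ × ℝ) (x : ℝ) : ℂ :=
  Complex.exp (Complex.I * ((s.1 * x + s.2 * x ^ 2 : ℝ) : ℂ))

@[simp]
lemma norm_chirp (s : ℝ × ℝ) (x : ℝ) : ‖chirp s x‖ = 1 :=
  Complex.norm_exp_I_mul_ofReal _

@[simp]
lemma chirp_zero (x : ℝ) : chirp 0 x = 1 := by
  simp [chirp]

lemma chirp_add (s t : ℝ × ℝ) (x : ℝ) : chirp (s + t) x = chirp s x * chirp t x := by
  rw [chirp, chirp, chirp, ← Complex.exp_add]
  congr 1
  push_cast [Prod.fst_add, Prod.snd_add]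
  ring

lemma chirp_nsmul (n : ℕ) (s : ℝ × ℝ) (x : ℝ) : chirp (n • s) x = chirp s x ^ n := by
  induction n with
  | zero => simp
  | succ n ih => rw [succ_nsmul, chirp_add, ih, pow_succ]

lemma chirp_sum {ι : Type*} (t : Finset ι) (s : ι → ℝ × ℝ) (x : ℝ) :
    chirp (∑ i ∈ t, s i) x = ∏ i ∈ t, chirp (s i) x := by
  classical
  induction t using Finset.induction_on with
  | empty => simp
  | insert i t hi ih => rw [sum_insert hi, prod_insert hi, chirp_add, ih]

lemma conj_chirp (s : ℝ × ℝ) (x : ℝ) : conj (chirp s x) = chirp (-s) x := by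
  rw [chirp, chirp, ← Complex.exp_conj]
  congr 1
  simp only [map_mul, Complex.conj_I, Complex.conj_ofReal, Prod.fst_neg, Prod.snd_neg]
  push_cast
  ring

@[fun_prop]
lemma continuous_chirp (s : ℝ × ℝ) : Continuous (chirp s) := by
  unfold chirp
  fun_prop

lemma norm_chirp_sub_chirp_le (s t : ℝ × ℝ) (x : ℝ) :
    ‖chirp s x - chirp t x‖ ≤ |s.1 - t.1| * |x| + |s.2 - t.2| * x ^ 2 := by
  have h : chirp s x - chirp t x = chirp t x * (chirp (s - t) x - 1) := by
    rw [mul_sub, ← chirp_add, mul_one, add_sub_cancel]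
  rw [h, norm_mul, norm_chirp, one_mul, chirp]
  refine Real.norm_exp_I_mul_ofReal_sub_one_le.trans ?_
  rw [Real.norm_eq_abs]
  refine (abs_add_le _ _).trans (le_of_eq ?_)
  rw [abs_mul, abs_mul, abs_of_nonneg (sq_nonneg x), Prod.fst_sub, Prod.snd_sub]

lemma chirpPolynomial_eq {k : ℕ} (ω c α : Fin k → ℝ) (B : Fin k → ℂ) (x : ℝ) :
    chirpPolynomial ω c α B x = ∑ j, B j * chirp (ω j - c j * α j, c j) x := by
  unfold chirpPolynomial chirp
  refine sum_congr rfl fun j _ => ?_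
  congr 4
  ring

lemma trigPolynomial_eq {k : ℕ} (ω : Fin k → ℝ) (B : Fin k → ℂ) (x : ℝ) :
    trigPolynomial ω B x = ∑ j, B j * chirp (2 * Real.pi * ω j, 0) x := by
  simp [trigPolynomial, chirp]

/-! ### Sampling along equidistributed sequences -/

/-- A sequence along which every non-constant quadratic phase has mean zero: Weyl's criterion for
the points `(x n, x n ^ 2)` to be equidistributed in the square of the Bohr compactification of
the line. -/
def ChirpEquidistributed (x : ℕ → ℝ) : Prop :=
  ∀ s : ℝ × ℝ, s ≠ 0 →
    Tendsto (fun N : ℕ => (N : ℂ)⁻¹ * ∑ n ∈ range N, chirp s (x n)) atTop (𝓝 0)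

namespace ChirpEquidistributed

variable {x : ℕ → ℝ}

lemma tendsto_mean (hx : ChirpEquidistributed x) (s : ℝ × ℝ) :
    Tendsto (fun N : ℕ => (N : ℂ)⁻¹ * ∑ n ∈ range N, chirp s (x n)) atTop
      (𝓝 (if s = 0 then 1 else 0)) := by
  split_ifs with hs
  · subst hs
    refine tendsto_const_nhds.congr' ?_
    filter_upwards [eventually_ne_atTop 0] with N hN
    simp [hN]
  · exact hx s hs

/-- Parseval's identity for the mean along an equidistributed sequence. -/
lemma tendsto_mean_norm_sq (hx : ChirpEquidistributed x) (S : Finset (ℝ × ℝ)) (C : ℝ × ℝ → ℂ) :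
    Tendsto (fun N : ℕ => (N : ℝ)⁻¹ * ∑ n ∈ range N, ‖∑ s ∈ S, C s * chirp s (x n)‖ ^ 2) atTop
      (𝓝 (∑ s ∈ S, ‖C s‖ ^ 2)) := by
  have key : Tendsto (fun N : ℕ => ∑ s ∈ S, ∑ t ∈ S, C s * conj (C t) *
      ((N : ℂ)⁻¹ * ∑ n ∈ range N, chirp (s - t) (x n))) atTop
      (𝓝 (∑ s ∈ S, ∑ t ∈ S, C s * conj (C t) * (if s - t = 0 then 1 else 0))) :=
    tendsto_finsetSum _ fun s _ => tendsto_finsetSum _ fun t _ =>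
      (hx.tendsto_mean (s - t)).const_mul _
  have hlim : (∑ s ∈ S, ∑ t ∈ S, C s * conj (C t) * (if s - t = 0 then 1 else 0) : ℂ)
      = ((∑ s ∈ S, ‖C s‖ ^ 2 : ℝ) : ℂ) := by
    push_cast
    refine sum_congr rfl fun s hs => ?_
    rw [sum_eq_single s]
    · simp [Complex.mul_conj']
    · intro t _ hts
      simp [sub_eq_zero, hts.symm]
    · exact fun h => absurd hs h
  rw [hlim] at key
  have hre := (Complex.continuous_re.tendsto _).comp key
  rw [Complex.ofReal_re] at hre
  refine hre.congr fun N => ?_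
  rw [← Complex.ofReal_re ((N : ℝ)⁻¹ * _)]
  simp only [Function.comp_apply]
  congr 1
  push_cast
  simp only [← Complex.mul_conj', map_sum, map_mul, conj_chirp, sum_mul_sum]
  simp only [mul_sum]
  rw [sum_comm_cycle]
  refine sum_congr rfl fun n _ => sum_congr rfl fun s _ => sum_congr rfl fun t _ => ?_
  rw [sub_eq_add_neg, chirp_add]
  ring

/-- A bound at the sampling points costs only a factor depending on the number of phases when it is
transferred to an arbitrary point: Cauchy–Schwarz combined with Parseval. -/
lemma norm_sq_le_card_mul (hx : ChirpEquidistributed x) (S : Finset (ℝ × ℝ)) (C : ℝ × ℝ → ℂ)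
    {M : ℝ} (hM : ∀ n, ‖∑ s ∈ S, C s * chirp s (x n)‖ ^ 2 ≤ M) (y : ℝ) :
    ‖∑ s ∈ S, C s * chirp s y‖ ^ 2 ≤ #S * M := by
  have h1 : ∑ s ∈ S, ‖C s‖ ^ 2 ≤ M := by
    refine le_of_tendsto (hx.tendsto_mean_norm_sq S C) ?_
    filter_upwards [eventually_gt_atTop 0] with N hN
    have hN' : (0 : ℝ) < N := by exact_mod_cast hN
    rw [inv_mul_le_iff₀ hN']
    refine (sum_le_sum fun n _ => hM n).trans ?_
    simp
  calc ‖∑ s ∈ S, C s * chirp s y‖ ^ 2 ≤ (∑ s ∈ S, ‖C s‖) ^ 2 := by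
        gcongr
        refine (norm_sum_le _ _).trans (le_of_eq ?_)
        simp
    _ ≤ #S * ∑ s ∈ S, ‖C s‖ ^ 2 := sq_sum_le_card_mul_sum_sq
    _ ≤ #S * M := by gcongr

/-- The phases occurring in the `m`-th power of a combination of `k` phases are among
`∑ a j • q j` with `∑ a j = m`, so there are at most `(m + 1) ^ k` of them. -/
lemma norm_sum_sq_pow_le (hx : ChirpEquidistributed x) {k : ℕ} (q : Fin k → ℝ × ℝ) (B : Fin k → ℂ)
    {ε : ℝ} (h : ∀ n, ‖∑ j, B j * chirp (q j) (x n)‖ ≤ ε) (y : ℝ) (m : ℕ) :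
    (‖∑ j, B j * chirp (q j) y‖ ^ 2) ^ m ≤ ((m : ℝ) + 1) ^ k * (ε ^ 2) ^ m := by
  classical
  set A : Finset (Fin k → ℕ) := piAntidiag univ m with hA
  set φ : (Fin k → ℕ) → ℝ × ℝ := fun a => ∑ j, a j • q j
  set w : (Fin k → ℕ) → ℂ := fun a => Nat.multinomial univ a * ∏ j, B j ^ a j
  set C : ℝ × ℝ → ℂ := fun s => ∑ a ∈ A with φ a = s, w a
  have hpow (z : ℝ) : (∑ j, B j * chirp (q j) z) ^ m = ∑ s ∈ A.image φ, C s * chirp s z := by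
    rw [sum_pow_eq_sum_piAntidiag,
      ← sum_fiberwise_of_maps_to (fun a ha => mem_image_of_mem φ ha)]
    refine sum_congr rfl fun s _ => ?_
    rw [sum_mul]
    refine sum_congr rfl fun a ha => ?_
    rw [← (mem_filter.1 ha).2, chirp_sum]
    simp only [chirp_nsmul, mul_pow, prod_mul_distrib, w, mul_assoc]
  have hcard : #(A.image φ) ≤ (m + 1) ^ k := by
    refine card_image_le.trans ?_
    have hsub : A ⊆ Fintype.piFinset fun _ : Fin k => range (m + 1) := by
      intro a ha
      rw [hA, mem_piAntidiag] at ha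
      refine Fintype.mem_piFinset.2 fun j => mem_range.2 (Nat.lt_succ_of_le ?_)
      rw [← ha.1]
      exact single_le_sum (fun i _ => Nat.zero_le _) (mem_univ j)
    refine (card_le_card hsub).trans ?_
    simp [Fintype.card_piFinset]
  have hb := hx.norm_sq_le_card_mul (A.image φ) C (M := (ε ^ 2) ^ m) (fun n => by
    rw [← hpow, norm_pow, pow_right_comm]
    gcongr
    exact h n) y
  rw [← hpow, norm_pow, pow_right_comm] at hb
  refine hb.trans ?_
  gcongr
  exact_mod_cast hcard

/-- A combination of quadratic phases is bounded everywhere by any bound it satisfies along an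
equidistributed sequence. Applied to the `m`-th power, the previous estimates lose only a factor
polynomial in `m`, which disappears on taking `m`-th roots. -/
lemma norm_sum_le (hx : ChirpEquidistributed x) {k : ℕ} (q : Fin k → ℝ × ℝ) (B : Fin k → ℂ)
    {ε : ℝ} (hε : 0 < ε) (h : ∀ n, ‖∑ j, B j * chirp (q j) (x n)‖ ≤ ε) (y : ℝ) :
    ‖∑ j, B j * chirp (q j) y‖ ≤ ε := by
  by_contra! hlt
  set r : ℝ := ‖∑ j, B j * chirp (q j) y‖ ^ 2 / ε ^ 2 with hr
  have hr1 : 1 < r := by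
    rw [hr, one_lt_div (by positivity)]
    gcongr
  have hbound (m : ℕ) : r ^ m ≤ ((m : ℝ) + 1) ^ k := by
    rw [hr, div_pow, div_le_iff₀ (by positivity)]
    exact hx.norm_sum_sq_pow_le q B h y m
  have hlim := (tendsto_add_atTop_iff_nat 1).2 (tendsto_pow_const_div_const_pow_of_one_lt k hr1)
  have hinv : (0 : ℝ) < r⁻¹ := by positivity
  obtain ⟨m, hm⟩ := (hlim.eventually_lt_const hinv).exists
  have hrm : (0 : ℝ) < r ^ m := by positivity
  rw [div_lt_iff₀ (by positivity), pow_succ', inv_mul_cancel_left₀ (by positivity)] at hm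
  push_cast at hm
  exact absurd (hbound m) (not_le.2 hm)

/-- An equidistributed sequence is a set of uniqueness for the linear chirp functions. -/
theorem eq_zero_of_forall_eq_zero (hx : ChirpEquidistributed x) {f : ℝ → ℂ}
    (hf : f ∈ linearChirpSpace) (h0 : ∀ n, f (x n) = 0) (y : ℝ) : f y = 0 := by
  rw [← norm_le_zero_iff]
  refine le_of_forall_pos_le_add fun ε hε => ?_
  obtain ⟨k, ω, c, α, B, hP⟩ := hf (ε / 2) (half_pos hε)
  simp only [chirpPolynomial_eq] at hP
  have h1 := hx.norm_sum_le (fun j => (ω j - c j * α j, c j)) B (half_pos hε)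
    (fun n => by simpa [h0 n] using hP (x n)) y
  have h2 := norm_le_norm_add_norm_sub' (f y) (∑ j, B j * chirp (ω j - c j * α j, c j) y)
  linarith [hP y]

end ChirpEquidistributed

/-! ### Almost periodic functions -/

lemma almostPeriodicSpace_subset : almostPeriodicSpace ⊆ linearChirpSpace := by
  intro f hf ε hε
  obtain ⟨k, ω, B, h⟩ := hf ε hε
  refine ⟨k, fun j => 2 * Real.pi * ω j, 0, 0, B, fun x => ?_⟩
  simpa [chirpPolynomial, trigPolynomial] using h x

lemma chirp_mem_linearChirpSpace (s : ℝ × ℝ) : chirp s ∈ linearChirpSpace := by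
  intro ε hε
  refine ⟨1, fun _ => s.1, fun _ => s.2, 0, fun _ => 1, fun x => ?_⟩
  simp [chirpPolynomial_eq, hε.le]

/-- A phase with a genuine quadratic term is not almost periodic: it is orthogonal, for the mean
along an equidistributed sequence, to every trigonometric polynomial, whereas its own square mean
is `1`. -/
lemma chirp_notMem_almostPeriodicSpace {x : ℕ → ℝ} (hx : ChirpEquidistributed x) {s : ℝ × ℝ}
    (hs : s.2 ≠ 0) : chirp s ∉ almostPeriodicSpace := by
  intro hmem
  obtain ⟨k, ω, B, hT⟩ := hmem (1 / 2) one_half_pos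
  simp only [trigPolynomial_eq] at hT
  have hlim : Tendsto (fun N : ℕ => (N : ℂ)⁻¹ * ∑ n ∈ range N, chirp (0 : ℝ × ℝ) (x n) -
      ∑ j, B j * ((N : ℂ)⁻¹ * ∑ n ∈ range N, chirp ((2 * Real.pi * ω j, 0) - s) (x n))) atTop
      (𝓝 (1 - ∑ j, B j * 0)) := by
    refine Tendsto.sub (by simpa only [if_true] using hx.tendsto_mean 0) ?_
    refine tendsto_finsetSum _ fun j _ => (hx _ fun h => hs ?_).const_mul _
    simpa using congrArg Prod.snd h
  have hle : ‖(1 : ℂ) - ∑ j, B j * 0‖ ≤ 1 / 2 := by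
    refine le_of_tendsto hlim.norm ?_
    filter_upwards [eventually_gt_atTop 0] with N hN
    have hN' : (0 : ℝ) < N := by exact_mod_cast hN
    have heq : (N : ℂ)⁻¹ * ∑ n ∈ range N, chirp (0 : ℝ × ℝ) (x n) -
        ∑ j, B j * ((N : ℂ)⁻¹ * ∑ n ∈ range N, chirp ((2 * Real.pi * ω j, 0) - s) (x n)) =
        (N : ℂ)⁻¹ * ∑ n ∈ range N, chirp (-s) (x n) *
          (chirp s (x n) - ∑ j, B j * chirp (2 * Real.pi * ω j, 0) (x n)) := by
      simp only [mul_sub, ← chirp_add, neg_add_cancel, sum_sub_distrib, mul_sum, sub_right_inj]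
      rw [sum_comm]
      refine sum_congr rfl fun n _ => sum_congr rfl fun j _ => ?_
      rw [sub_eq_neg_add, chirp_add]
      ring
    rw [heq, norm_mul, norm_inv, Complex.norm_natCast, inv_mul_le_iff₀ hN']
    refine (norm_sum_le _ _).trans ((sum_le_sum (g := fun _ => (1 / 2 : ℝ)) fun n _ => ?_).trans ?_)
    · rw [norm_mul, norm_chirp, one_mul]
      exact hT (x n)
    · simp
  norm_num at hle

end

section

open Filter Topology Finset MeasureTheory ProbabilityTheory

/-! ### Cell averages of quadratic phases -/

/-- The average of the phase `s` over the cell `[n λ, (n + 1) λ]`. -/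
noncomputable def cellMean (lam : ℝ) (s : ℝ × ℝ) (n : ℕ) : ℂ :=
  (lam : ℂ)⁻¹ * ∫ y in (0 : ℝ)..lam, chirp s (n * lam + y)

/-- Moving along the line turns a quadratic term into an ever higher frequency, so the
Riemann–Lebesgue lemma applies. -/
lemma tendsto_cellMean_zero {lam : ℝ} (hlam : 0 < lam) {s : ℝ × ℝ} (hs : s.2 ≠ 0) :
    Tendsto (cellMean lam s) atTop (𝓝 0) := by
  set g : ℝ → ℂ := Set.indicator (Set.Ioc 0 lam) (chirp s) with hg
  have hRL := Real.tendsto_integral_exp_smul_cocompact g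
  have hfreq : Tendsto (fun n : ℕ => -(s.2 * lam / Real.pi) * (n : ℝ)) atTop
      (cocompact ℝ) := by
    have hne : -(s.2 * lam / Real.pi) ≠ 0 := by
      have := Real.pi_pos.ne'
      have := hlam.ne'
      simp [*]
    rcases hne.lt_or_gt with h | h
    · exact (tendsto_natCast_atTop_atTop.const_mul_atTop_of_neg h).mono_right atBot_le_cocompact
    · exact (tendsto_natCast_atTop_atTop.const_mul_atTop h).mono_right atTop_le_cocompact
  have hlim := hRL.comp hfreq
  have heq (n : ℕ) : cellMean lam s n = (lam : ℂ)⁻¹ * (chirp s (n * lam) *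
      ∫ v : ℝ, Real.fourierChar (-(v * (-(s.2 * lam / Real.pi) * (n : ℝ)))) • g v) := by
    rw [cellMean, intervalIntegral.integral_of_le hlam.le, ← integral_indicator measurableSet_Ioc,
      ← integral_const_mul (chirp s (n * lam))]
    congr 2
    ext v
    by_cases hv : v ∈ Set.Ioc 0 lam
    · rw [hg, Set.indicator_of_mem hv, Set.indicator_of_mem hv, Circle.smul_def,
        Real.fourierChar_apply, smul_eq_mul]
      simp only [chirp]
      rw [← Complex.exp_add, ← Complex.exp_add]
      congr 1
      have hpi : (Real.pi : ℂ) ≠ 0 := by exact_mod_cast Real.pi_pos.ne'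
      push_cast
      field_simp
      ring
    · simp [hg, Set.indicator_of_notMem hv]
  rw [tendsto_zero_iff_norm_tendsto_zero]
  have h0 := hlim.norm.const_mul ‖(lam : ℂ)⁻¹‖
  rw [norm_zero, mul_zero] at h0
  refine h0.congr fun n => ?_
  rw [heq, norm_mul, norm_mul, norm_chirp, one_mul]
  rfl

/-- For a linear phase the cell averages telescope. -/
lemma norm_sum_cellMean_le {lam : ℝ} {s : ℝ × ℝ} (h1 : s.1 ≠ 0) (h2 : s.2 = 0) (N : ℕ) :
    ‖∑ n ∈ range N, cellMean lam s n‖ ≤ ‖(lam : ℂ)⁻¹‖ * (2 / ‖s.1‖) := by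
  have hne : Complex.I * (s.1 : ℂ) ≠ 0 := by simp [h1]
  have hcell (n : ℕ) : ∫ y in (0 : ℝ)..lam, chirp s (n * lam + y) =
      (chirp s ((n + 1 : ℕ) * lam) - chirp s (n * lam)) / (Complex.I * s.1) := by
    have hchirp (x : ℝ) : chirp s x = Complex.exp (Complex.I * s.1 * x) := by
      simp [chirp, h2, mul_assoc]
    rw [intervalIntegral.integral_comp_add_left (fun y => chirp s y)]
    simp only [hchirp]
    rw [integral_exp_mul_complex hne]
    push_cast
    ring_nf
  simp only [cellMean, hcell]
  rw [← mul_sum, ← sum_div, sum_range_sub (fun n : ℕ => chirp s (n * lam)), norm_mul]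
  gcongr
  rw [norm_div, norm_mul, Complex.norm_I, one_mul, Complex.norm_real]
  gcongr
  refine (norm_sub_le _ _).trans ?_
  rw [norm_chirp, norm_chirp]
  norm_num

lemma tendsto_mean_cellMean {lam : ℝ} (hlam : 0 < lam) {s : ℝ × ℝ} (hs : s ≠ 0) :
    Tendsto (fun N : ℕ => (N : ℂ)⁻¹ * ∑ n ∈ range N, cellMean lam s n) atTop (𝓝 0) := by
  by_cases h2 : s.2 = 0
  · have h1 : s.1 ≠ 0 := fun h1 => hs (Prod.ext h1 h2)
    refine squeeze_zero_norm (a := fun N : ℕ => (N : ℝ)⁻¹ * (‖(lam : ℂ)⁻¹‖ * (2 / ‖s.1‖)))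
      (fun N => ?_) ?_
    · rw [norm_mul, norm_inv, Complex.norm_natCast]
      gcongr
      exact norm_sum_cellMean_le h1 h2 N
    · simpa using (tendsto_inv_atTop_nhds_zero_nat (𝕜 := ℝ)).mul_const (‖(lam : ℂ)⁻¹‖ * (2 / ‖s.1‖))
  · refine (tendsto_cellMean_zero hlam h2).cesaro_smul.congr fun N => ?_
    rw [Complex.real_smul]
    push_cast
    rfl

/-! ### Concentration of the sampled phases -/

section Concentration

variable {Ω : Type*} [MeasurableSpace Ω] {P : Measure Ω}

/-- The deviation of a sum of sampled phases from its expectation. -/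
noncomputable def chirpDeviation (P : Measure Ω) (x : ℕ → Ω → ℝ) (s : ℝ × ℝ) (N : ℕ) (w : Ω) : ℂ :=
  ∑ n ∈ range N, (chirp s (x n w) - ∫ v, chirp s (x n v) ∂P)

variable [IsProbabilityMeasure P] {x : ℕ → Ω → ℝ}

lemma integrable_chirp (hx : ∀ n, Measurable (x n)) (s : ℝ × ℝ) (n : ℕ) :
    Integrable (fun w => chirp s (x n w)) P :=
  Integrable.of_bound ((continuous_chirp s).measurable.comp (hx n)).aestronglyMeasurable 1
    (ae_of_all _ fun w => by simp)

/-- Hoeffding's inequality for the component of the deviation in the direction `conj u`. -/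
lemma measureReal_le_re_chirpDeviation (hx : ∀ n, Measurable (x n)) (hind : iIndepFun x P)
    (s : ℝ × ℝ) {u : ℂ} (hu : ‖u‖ = 1) {t : ℝ} (ht : 0 ≤ t) (N : ℕ) :
    P.real {w | t * N ≤ (u * chirpDeviation P x s N w).re} ≤ Real.exp (-(t ^ 2 / 2) * N) := by
  have hmeas : Measurable fun y => (u * chirp s y).re :=
    (Complex.continuous_re.comp ((continuous_chirp s).const_mul u)).measurable
  have hint (n : ℕ) : ∫ w, (u * chirp s (x n w)).re ∂P = (u * ∫ w, chirp s (x n w) ∂P).re := by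
    rw [← integral_const_mul]
    exact integral_re ((integrable_chirp hx s n).const_mul u)
  have hsub (n : ℕ) : HasSubgaussianMGF
      (fun w => (u * chirp s (x n w)).re - ∫ v, (u * chirp s (x n v)).re ∂P) 1 P := by
    have := hasSubgaussianMGF_of_mem_Icc (μ := P) (X := fun w => (u * chirp s (x n w)).re)
      (a := -1) (b := 1) (hmeas.comp (hx n)).aemeasurable (ae_of_all _ fun w => by
        rw [Set.mem_Icc, ← abs_le]
        refine (Complex.abs_re_le_norm _).trans ?_
        simp [hu])
    convert this using 1
    rw [← NNReal.coe_inj]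
    norm_num
  have hindep : iIndepFun
      (fun n w => (u * chirp s (x n w)).re - ∫ v, (u * chirp s (x n v)).re ∂P) P :=
    hind.comp (fun n y => (u * chirp s y).re - ∫ v, (u * chirp s (x n v)).re ∂P)
      fun n => hmeas.sub_const _
  have hH := HasSubgaussianMGF.measure_sum_range_ge_le_of_iIndepFun hindep (n := N)
    (fun n _ => hsub n) (ε := t * N) (by positivity)
  refine (le_of_eq ?_).trans (hH.trans (le_of_eq ?_))
  · congr 1
    ext w
    simp only [Set.mem_ofPred_eq, chirpDeviation, mul_sum, Complex.re_sum, mul_sub, Complex.sub_re,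
      hint]
  · congr 1
    rcases eq_or_ne (N : ℝ) 0 with h | h
    · simp [h]
    · simp only [NNReal.coe_one]
      field_simp

lemma measure_le_norm_chirpDeviation (hx : ∀ n, Measurable (x n)) (hind : iIndepFun x P)
    (s : ℝ × ℝ) {t : ℝ} (ht : 0 ≤ t) (N : ℕ) :
    P {w | 2 * (t * N) ≤ ‖chirpDeviation P x s N w‖} ≤
      ENNReal.ofReal (4 * Real.exp (-(t ^ 2 / 2) * N)) := by
  set E : ℂ → Set Ω := fun u => {w | t * N ≤ (u * chirpDeviation P x s N w).re}
  have hE (u : ℂ) (hu : ‖u‖ = 1) : P.real (E u) ≤ Real.exp (-(t ^ 2 / 2) * N) :=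
    measureReal_le_re_chirpDeviation hx hind s hu ht N
  have hsub : {w | 2 * (t * N) ≤ ‖chirpDeviation P x s N w‖} ⊆
      (E 1 ∪ E (-1)) ∪ (E Complex.I ∪ E (-Complex.I)) := by
    intro w hw
    by_contra hnot
    simp only [E, Set.mem_union, Set.mem_ofPred_eq, not_or, not_le, one_mul, neg_mul, Complex.neg_re,
      Complex.I_mul_re, neg_neg] at hnot hw
    have hre := abs_lt.2 ⟨neg_lt.1 hnot.1.2, hnot.1.1⟩
    have him := abs_lt.2 ⟨neg_lt.1 hnot.2.1, hnot.2.2⟩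
    linarith [Complex.norm_le_abs_re_add_abs_im (chirpDeviation P x s N w)]
  refine ENNReal.le_ofReal_iff_toReal_le (measure_ne_top _ _) (by positivity) |>.2 ?_
  change P.real _ ≤ _
  refine (measureReal_mono hsub).trans ?_
  linarith [measureReal_union_le (μ := P) (E 1 ∪ E (-1)) (E Complex.I ∪ E (-Complex.I)),
    measureReal_union_le (μ := P) (E 1) (E (-1)),
    measureReal_union_le (μ := P) (E Complex.I) (E (-Complex.I)),
    hE 1 (by simp), hE (-1) (by simp), hE Complex.I (by simp), hE (-Complex.I) (by simp)]

/-- The point with label `p` of the net used at time `N`. The meshes `N⁻²` and `N⁻³` make the error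
`|Δβ| |x| + |Δγ| x²` of order `N⁻¹` at sampling points of size `O(N)`. -/
noncomputable def netPoint (N : ℕ) (p : ℤ × ℤ) : ℝ × ℝ :=
  ((p.1 : ℝ) / N ^ 2, (p.2 : ℝ) / N ^ 3)

/-- The labels of the net at time `N`: the net covers `[-N, N] × [-N, N]`. -/
noncomputable def netLabels (N : ℕ) : Finset (ℤ × ℤ) :=
  Icc (-(N : ℤ) ^ 3) ((N : ℤ) ^ 3) ×ˢ Icc (-(N : ℤ) ^ 4) ((N : ℤ) ^ 4)

lemma card_netLabels (N : ℕ) : #(netLabels N) = (2 * N ^ 3 + 1) * (2 * N ^ 4 + 1) := by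
  rw [netLabels, card_product, Int.card_Icc, Int.card_Icc]
  simp only [← Nat.cast_pow]
  congr 1 <;> omega

lemma exists_netPoint_near {N : ℕ} (hN : 0 < N) {s : ℝ × ℝ} (h1 : |s.1| ≤ N) (h2 : |s.2| ≤ N) :
    ∃ p ∈ netLabels N, |s.1 - (netPoint N p).1| ≤ 1 / (N : ℝ) ^ 2 ∧
      |s.2 - (netPoint N p).2| ≤ 1 / (N : ℝ) ^ 3 := by
  have hN' : (0 : ℝ) < N := by exact_mod_cast hN
  have key (a : ℝ) (d : ℕ) (ha : |a| ≤ N) : ⌊a * N ^ d⌋ ∈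
      Icc (-(N : ℤ) ^ (d + 1)) ((N : ℤ) ^ (d + 1)) ∧
      |a - (⌊a * N ^ d⌋ : ℝ) / N ^ d| ≤ 1 / (N : ℝ) ^ d := by
    have hd : (0 : ℝ) < (N : ℝ) ^ d := by positivity
    obtain ⟨hl, hr⟩ := abs_le.1 ha
    refine ⟨mem_Icc.2 ⟨Int.le_floor.2 ?_, ?_⟩, ?_⟩
    · push_cast
      rw [pow_succ', ← neg_mul]
      gcongr
    · have : a * (N : ℝ) ^ d ≤ ((N : ℤ) ^ (d + 1) : ℤ) := by
        push_cast
        rw [pow_succ']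
        gcongr
      exact_mod_cast (Int.floor_le _).trans this
    · have : a - (⌊a * N ^ d⌋ : ℝ) / N ^ d = Int.fract (a * (N : ℝ) ^ d) / N ^ d := by
        rw [← Int.self_sub_floor, sub_div, mul_div_cancel_right₀ _ hd.ne']
      rw [this, abs_of_nonneg (div_nonneg (Int.fract_nonneg _) hd.le)]
      gcongr
      exact (Int.fract_lt_one _).le
  obtain ⟨a1, a2⟩ := key s.1 2 h1
  obtain ⟨b1, b2⟩ := key s.2 3 h2
  exact ⟨(⌊s.1 * N ^ 2⌋, ⌊s.2 * N ^ 3⌋), mem_product.2 ⟨a1, b1⟩, a2, b2⟩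

/-- The net has polynomially many points whereas the deviation bound is exponentially small, so by
Borel–Cantelli the deviation is eventually small on the whole net. -/
lemma ae_eventually_norm_chirpDeviation_netPoint_lt (hx : ∀ n, Measurable (x n))
    (hind : iIndepFun x P) {t : ℝ} (ht : 0 < t) :
    ∀ᵐ w ∂P, ∀ᶠ N : ℕ in atTop, ∀ p ∈ netLabels N,
      ‖chirpDeviation P x (netPoint N p) N w‖ < 2 * (t * N) := by
  set r : ℝ := t ^ 2 / 2 with hr
  have hr0 : 0 < r := by positivity
  have hsum : Summable fun N : ℕ =>
      (((2 * N ^ 3 + 1) * (2 * N ^ 4 + 1) : ℕ) : ℝ) * (4 * Real.exp (-r * N)) := by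
    have h := fun k => Real.summable_pow_mul_exp_neg_nat_mul k hr0
    refine ((((h 7).mul_left 16).add ((h 3).mul_left 8)).add
      (((h 4).mul_left 8).add ((h 0).mul_left 4))).congr fun N => ?_
    push_cast
    ring
  have hBC := ae_eventually_notMem (μ := P) (s := fun N : ℕ => ⋃ p ∈ netLabels N,
      {w | 2 * (t * N) ≤ ‖chirpDeviation P x (netPoint N p) N w‖}) (by
    refine ne_top_of_le_ne_top hsum.tsum_ofReal_ne_top (ENNReal.tsum_le_tsum fun N => ?_)
    refine (measure_biUnion_finset_le _ _).trans ((sum_le_sum fun p _ =>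
      measure_le_norm_chirpDeviation hx hind (netPoint N p) ht.le N).trans ?_)
    rw [sum_const, card_netLabels, nsmul_eq_mul, ← ENNReal.ofReal_natCast,
      ← ENNReal.ofReal_mul (Nat.cast_nonneg _)])
  filter_upwards [hBC] with w hw
  filter_upwards [hw] with N hN p hp
  by_contra! h
  exact hN (Set.mem_biUnion hp h)

/-- On points of size `O(N)` the deviation at an arbitrary phase differs by `O(1)` from the
deviation at a nearby point of the net. -/
lemma norm_chirpDeviation_le_add (hx : ∀ n, Measurable (x n)) {L : ℝ}
    (hL : ∀ n, ∀ᵐ w ∂P, |x n w| ≤ (n + 1) * L) {w : Ω} (hw : ∀ n, |x n w| ≤ (n + 1) * L)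
    {N : ℕ} (hN : 0 < N) {s s' : ℝ × ℝ} (h1 : |s.1 - s'.1| ≤ 1 / (N : ℝ) ^ 2)
    (h2 : |s.2 - s'.2| ≤ 1 / (N : ℝ) ^ 3) :
    ‖chirpDeviation P x s N w‖ ≤ ‖chirpDeviation P x s' N w‖ + 2 * (L + L ^ 2) := by
  have hN' : (0 : ℝ) < N := by exact_mod_cast hN
  have hL0 : 0 ≤ L := by simpa using (abs_nonneg _).trans (hw 0)
  have hpt (n : ℕ) (hn : n < N) (y : ℝ) (hy : |y| ≤ (n + 1) * L) :
      ‖chirp s y - chirp s' y‖ ≤ (L + L ^ 2) / N := by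
    have hyN : |y| ≤ N * L := hy.trans (by gcongr; exact_mod_cast hn)
    refine (norm_chirp_sub_chirp_le s s' y).trans ?_
    rw [← sq_abs y]
    calc |s.1 - s'.1| * |y| + |s.2 - s'.2| * |y| ^ 2
        ≤ 1 / (N : ℝ) ^ 2 * (N * L) + 1 / (N : ℝ) ^ 3 * (N * L) ^ 2 := by gcongr
      _ = (L + L ^ 2) / N := by field_simp
  have hterm (n : ℕ) (hn : n < N) :
      ‖(chirp s (x n w) - ∫ v, chirp s (x n v) ∂P) -
        (chirp s' (x n w) - ∫ v, chirp s' (x n v) ∂P)‖ ≤ 2 * ((L + L ^ 2) / N) := by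
    rw [sub_sub_sub_comm, ← integral_sub (integrable_chirp hx s n) (integrable_chirp hx s' n)]
    refine (norm_sub_le _ _).trans ?_
    rw [two_mul]
    refine add_le_add (hpt n hn _ (hw n)) ?_
    refine (norm_integral_le_of_norm_le_const (C := (L + L ^ 2) / N) ?_).trans (by simp)
    filter_upwards [hL n] with v hv using hpt n hn _ hv
  have hdiff : ‖chirpDeviation P x s N w - chirpDeviation P x s' N w‖ ≤ 2 * (L + L ^ 2) := by
    rw [chirpDeviation, chirpDeviation, ← sum_sub_distrib]
    refine (norm_sum_le_of_le _ fun n hn => hterm n (mem_range.1 hn)).trans (le_of_eq ?_)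
    rw [sum_const, card_range, nsmul_eq_mul]
    field_simp
  linarith [norm_le_norm_add_norm_sub' (chirpDeviation P x s N w) (chirpDeviation P x s' N w)]

/-- A uniform strong law of large numbers: almost surely the mean deviation tends to zero for all
quadratic phases simultaneously. -/
lemma ae_forall_tendsto_chirpDeviation (hx : ∀ n, Measurable (x n)) (hind : iIndepFun x P) {L : ℝ}
    (hL : ∀ n, ∀ᵐ w ∂P, |x n w| ≤ (n + 1) * L) :
    ∀ᵐ w ∂P, ∀ s, Tendsto (fun N : ℕ => (N : ℂ)⁻¹ * chirpDeviation P x s N w) atTop (𝓝 0) := by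
  have hnet : ∀ᵐ w ∂P, ∀ k : ℕ, ∀ᶠ N : ℕ in atTop, ∀ p ∈ netLabels N,
      ‖chirpDeviation P x (netPoint N p) N w‖ < 2 * (1 / ((k : ℝ) + 1) * N) :=
    ae_all_iff.2 fun k => ae_eventually_norm_chirpDeviation_netPoint_lt hx hind (by positivity)
  filter_upwards [hnet, ae_all_iff.2 hL] with w hw hwL s
  rw [Metric.tendsto_nhds]
  intro δ hδ
  obtain ⟨k, hk⟩ := exists_nat_one_div_lt (show 0 < δ / 4 by positivity)
  have hlarge := tendsto_natCast_atTop_atTop (R := ℝ)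
  filter_upwards [hw k, eventually_gt_atTop 0, hlarge.eventually_ge_atTop |s.1|,
    hlarge.eventually_ge_atTop |s.2|, hlarge.eventually_gt_atTop (4 * (L + L ^ 2) / δ)]
    with N hNk hN h1 h2 hNL
  have hN' : (0 : ℝ) < N := by exact_mod_cast hN
  obtain ⟨p, hp, hp1, hp2⟩ := exists_netPoint_near hN h1 h2
  have hle := norm_chirpDeviation_le_add hx hL hwL hN hp1 hp2
  have hpk := hNk p hp
  rw [div_lt_iff₀ hδ] at hNL
  rw [dist_zero_right, norm_mul, norm_inv, Complex.norm_natCast, inv_mul_lt_iff₀ hN']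
  have hkN : 1 / ((k : ℝ) + 1) * N < δ / 4 * N := by gcongr
  linarith

end Concentration

/-! ### Perturbed arithmetic progressions -/

section Uniform

variable {Ω : Type*} [MeasurableSpace Ω] {P : Measure Ω} {lam : ℝ}

lemma ae_mem_Icc_of_isUniform {Y : Ω → ℝ} (hY : Measurable Y)
    (hunif : pdf.IsUniform Y (Set.Icc 0 lam) P volume) : ∀ᵐ w ∂P, Y w ∈ Set.Icc 0 lam := by
  have h : ∀ᵐ y ∂(P.map Y), y ∈ Set.Icc 0 lam := by
    rw [pdf.IsUniform] at hunif
    rw [hunif]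
    exact ae_cond_mem measurableSet_Icc
  exact ae_of_ae_map hY.aemeasurable h

lemma integral_chirp_of_isUniform (hlam : 0 < lam) {Y : Ω → ℝ} (hY : Measurable Y)
    (hunif : pdf.IsUniform Y (Set.Icc 0 lam) P volume) (s : ℝ × ℝ) (n : ℕ) :
    ∫ w, chirp s (n * lam + Y w) ∂P = cellMean lam s n := by
  rw [pdf.IsUniform] at hunif
  have hcont : Continuous fun y => chirp s (n * lam + y) := by fun_prop
  rw [← integral_map (φ := Y) (f := fun y => chirp s (n * lam + y)) hY.aemeasurable
    hcont.aestronglyMeasurable, hunif, ProbabilityTheory.cond, integral_smul_measure,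
    integral_Icc_eq_integral_Ioc, cellMean, intervalIntegral.integral_of_le hlam.le]
  simp [ENNReal.toReal_ofReal hlam.le]

theorem ae_chirpEquidistributed [IsProbabilityMeasure P] (hlam : 0 < lam) {X : ℕ → Ω → ℝ}
    (hmeas : ∀ n, Measurable (X n)) (hindep : iIndepFun X P)
    (hunif : ∀ n, pdf.IsUniform (X n) (Set.Icc 0 lam) P volume) :
    ∀ᵐ w ∂P, ChirpEquidistributed fun n => n * lam + X n w := by
  have hx (n : ℕ) : Measurable fun w => n * lam + X n w := (hmeas n).const_add _
  have hind : iIndepFun (fun (n : ℕ) w => n * lam + X n w) P :=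
    hindep.comp (fun (n : ℕ) y => n * lam + y) fun n => measurable_id.const_add _
  have hL (n : ℕ) : ∀ᵐ w ∂P, |n * lam + X n w| ≤ (n + 1) * lam := by
    filter_upwards [ae_mem_Icc_of_isUniform (hmeas n) (hunif n)] with w hw
    rw [abs_of_nonneg (add_nonneg (by positivity) hw.1), add_mul, one_mul]
    gcongr
    exact hw.2
  filter_upwards [ae_forall_tendsto_chirpDeviation hx hind hL] with w hw s hs
  have h := (hw s).add (tendsto_mean_cellMean hlam hs)
  rw [add_zero] at h
  refine h.congr fun N => ?_
  rw [← mul_add, chirpDeviation, ← sum_add_distrib]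
  simp only [integral_chirp_of_isUniform hlam (hmeas _) (hunif _), sub_add_cancel]

end Uniform

end

theorem theorem2 {Ω : Type*} [MeasurableSpace Ω] (P : MeasureTheory.Measure Ω)
    [MeasureTheory.IsProbabilityMeasure P] (lam : ℝ) (hlam : 0 < lam) (X : ℤ → Ω → ℝ)
    (hmeas : ∀ n, Measurable (X n)) (hindep : ProbabilityTheory.iIndepFun X P)
    (hunif : ∀ n, MeasureTheory.pdf.IsUniform (X n) (Set.Icc 0 lam) P MeasureTheory.volume) :
    (∀ᵐ w ∂P, ∀ f ∈ linearChirpSpace,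
      (∀ n : ℤ, f ((n : ℝ) * lam + X n w) = 0) → ∀ x : ℝ, f x = 0) ∧
    almostPeriodicSpace ⊂ linearChirpSpace := by
  have hequi := ae_chirpEquidistributed hlam (X := fun n : ℕ => X n) (fun n => hmeas n)
    (hindep.precomp Nat.cast_injective) (fun n => hunif n)
  refine ⟨?_, almostPeriodicSpace_subset, fun hsub => ?_⟩
  · filter_upwards [hequi] with w hw f hf h0
    exact hw.eq_zero_of_forall_eq_zero hf fun n => by simpa using h0 n
  · -- The existence of a single equidistributed sequence separates `exp (i x²)` from the almost
    -- periodic functions, and the random construction provides one.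
    obtain ⟨w, hw⟩ := hequi.exists
    exact chirp_notMem_almostPeriodicSpace hw (s := (0, 1)) one_ne_zero
      (hsub (chirp_mem_linearChirpSpace _))
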